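/- Let $\Bbbk$ be a field and let $T$ be a (finite) caterpillar graph, that is, a finite tree in which the removal of all pendant vertices (vertices of degree $1$) results in a chordless path with at least one vertex (so $T$ is not a single edge). A cutpoint of $T$ is a vertex whose removal, together with all its incident edges, results in a disconnected graph. Assume that every cutpoint of $T$ has degree at least $3$. Let $L(T)$ be the line graph of $T$, whose vertices are the edges of $T$, two distinct ones being adjacent if they share a vertex of $T$; let $R=\Bbbk[x_e : e\in E(T)]$ and let $I(L(T))=\langle x_e x_f : \{e,f\}\in E(L(T))\rangle\subseteq R$ be the edge ideal of $L(T)$. Then the Krull dimension of $R/I(L(T))$ is $$\dim R/I(L(T)) = s,$$ where $s$ is the number of cutpoints of $T$; moreover, $s$ equals the number of maximal cliques of $L(T)$ (cliques being nonempty). -/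

import Mathlib

namespace LineGraphEdgeIdeal

/-- A cutpoint of a graph: a vertex whose removal, together with all its incident edges, leaves a
disconnected graph. (The graph without vertices is not counted as disconnected.) -/
def IsCutpoint {V : Type*} (G : SimpleGraph V) (u : V) : Prop :=
  ¬ (G.induce {v | v ≠ u}).Preconnected

/-- A caterpillar: a tree in which the removal of all pendant vertices (the vertices of degree `1`)
results in a chordless path, the backbone, which has at least one vertex. -/
structure IsCaterpillar {V : Type*} [Fintype V] (G : SimpleGraph V) [DecidableRel G.Adj] :
    Prop where
  isTree : G.IsTree
  backbone : ∃ m : ℕ, 1 ≤ m ∧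
    Nonempty (G.induce {v | G.degree v ≠ 1} ≃g SimpleGraph.pathGraph m)

/-- The maximal cliques of a graph, given by their (nonempty) vertex sets. -/
def maximalCliques {V : Type*} (G : SimpleGraph V) : Set (Set V) :=
  {s | Maximal (fun t : Set V => t.Nonempty ∧ G.IsClique t) s}

/-- The edge ideal of a graph, in the polynomial ring with one variable for each vertex. -/
noncomputable def edgeIdeal (k : Type*) [Field k] {V : Type*} (G : SimpleGraph V) :
    Ideal (MvPolynomial V k) :=
  Ideal.span {p | ∃ i j : V, G.Adj i j ∧ p = MvPolynomial.X i * MvPolynomial.X j}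

end LineGraphEdgeIdeal

namespace LineGraphEdgeIdeal

/-! ### Dimension of an edge ring via independent sets -/

section KrullDim

variable {k : Type*} [Field k] {V : Type*} [Finite V] {G : SimpleGraph V}

/-! The dimension of an edge ring is the largest size of an independent set, which for `T.lineGraph`
is the largest size of a matching of `T`. Every edge of `T` contains a cutpoint, and edges of a
matching contain different ones, so a matching has at most `s` edges. Conversely a cutpoint has
three neighbours, at most two of them on the backbone, so it carries a pendant edge; these `s` edges
form a matching. Since `T` has no triangles, the cliques of `T.lineGraph` lie in stars, and the
maximal ones are exactly the stars at cutpoints. -/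

theorem ringKrullDim_mvPolynomial_field (σ : Type*) [Finite σ] :
    ringKrullDim (MvPolynomial σ k) = ((Nat.card σ : ℕ) : WithBot ℕ∞) := by
  rw [MvPolynomial.ringKrullDim_of_isNoetherianRing, ringKrullDim_eq_zero_of_field, zero_add]

/-- An independent set bounds the dimension of the edge ring from below: setting the other
variables to zero maps the edge ring onto a polynomial ring. -/
theorem ncard_le_ringKrullDim_quotient_edgeIdeal {S : Set V} (hS : G.IsIndepSet S) :
    ((S.ncard : ℕ) : WithBot ℕ∞) ≤ ringKrullDim (MvPolynomial V k ⧸ edgeIdeal k G) := by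
  classical
  let f : MvPolynomial V k →ₐ[k] MvPolynomial S k :=
    MvPolynomial.aeval fun v => if h : v ∈ S then MvPolynomial.X ⟨v, h⟩ else 0
  have hf : Function.Surjective f := by
    intro p
    refine ⟨MvPolynomial.rename Subtype.val p, ?_⟩
    have h : f.comp (MvPolynomial.rename Subtype.val) = AlgHom.id k (MvPolynomial S k) := by
      ext v
      simp [f]
    exact DFunLike.congr_fun h p
  have hI : ∀ p ∈ edgeIdeal k G, f.toRingHom p = 0 := by
    intro p hp
    have hle : edgeIdeal k G ≤ RingHom.ker f.toRingHom := by
      refine Ideal.span_le.2 ?_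
      rintro _ ⟨i, j, hij, rfl⟩
      have hij' : ¬ (i ∈ S ∧ j ∈ S) := fun h => hS h.1 h.2 hij.ne hij
      by_cases hi : i ∈ S
      · have hj : j ∉ S := fun hj => hij' ⟨hi, hj⟩
        simp [RingHom.mem_ker, f, hj]
      · simp [RingHom.mem_ker, f, hi]
    exact hle hp
  have h := ringKrullDim_le_of_surjective (Ideal.Quotient.lift (edgeIdeal k G) f.toRingHom hI)
    (Ideal.Quotient.lift_surjective_of_surjective _ hI hf)
  rwa [ringKrullDim_mvPolynomial_field, Nat.card_coe_set_eq] at h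

/-- The variables in `P` vanish in the quotient, so the others generate it. -/
theorem ringKrullDim_quotient_le_ncard_notMem (P : Ideal (MvPolynomial V k)) :
    ringKrullDim (MvPolynomial V k ⧸ P) ≤
      (({v : V | MvPolynomial.X v ∉ P}.ncard : ℕ) : WithBot ℕ∞) := by
  let S : Set V := {v | MvPolynomial.X v ∉ P}
  let f : MvPolynomial S k →ₐ[k] MvPolynomial V k ⧸ P :=
    (Ideal.Quotient.mkₐ k P).comp (MvPolynomial.rename Subtype.val)
  have hf : Function.Surjective f := by
    intro q
    obtain ⟨p, rfl⟩ := Ideal.Quotient.mk_surjective q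
    change Ideal.Quotient.mk P p ∈ f.range
    induction p using MvPolynomial.induction_on with
    | C a => exact ⟨MvPolynomial.C a, by simp [f]; rfl⟩
    | add p q hp hq => rw [map_add]; exact add_mem hp hq
    | mul_X p v hp =>
      rw [map_mul]
      refine mul_mem hp ?_
      by_cases hv : MvPolynomial.X v ∈ P
      · rw [Ideal.Quotient.eq_zero_iff_mem.2 hv]
        exact zero_mem _
      · exact ⟨MvPolynomial.X ⟨v, hv⟩, by simp [f]⟩
  have h := ringKrullDim_le_of_surjective f.toRingHom hf
  rwa [ringKrullDim_mvPolynomial_field, Nat.card_coe_set_eq] at h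

/-- A chain of primes containing `I` is also a chain of primes containing its least member. -/
theorem ringKrullDim_quotient_le_of_forall_isPrime {R : Type*} [CommRing R] (I : Ideal R)
    (d : WithBot ℕ∞) (h : ∀ P : Ideal R, P.IsPrime → I ≤ P → ringKrullDim (R ⧸ P) ≤ d) :
    ringKrullDim (R ⧸ I) ≤ d := by
  rw [ringKrullDim_quotient]
  refine iSup_le fun l => ?_
  have hd := h l.head.1.asIdeal l.head.1.isPrime l.head.2
  rw [ringKrullDim_quotient] at hd
  refine le_trans ?_ hd
  let l' : LTSeries (PrimeSpectrum.zeroLocus (l.head.1.asIdeal : Set R)) :=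
    { length := l.length
      toFun := fun i => ⟨(l i).1, fun _ hx => l.head_le i hx⟩
      step := fun i => l.step i }
  exact le_iSup (fun p : LTSeries _ => (p.length : WithBot ℕ∞)) l'

/-- A bound on the sizes of the independent sets bounds the dimension of the edge ring: the
variables outside a prime containing the edge ideal form an independent set. -/
theorem ringKrullDim_quotient_edgeIdeal_le {n : ℕ}
    (hn : ∀ S : Set V, G.IsIndepSet S → S.ncard ≤ n) :
    ringKrullDim (MvPolynomial V k ⧸ edgeIdeal k G) ≤ (n : WithBot ℕ∞) := by
  refine ringKrullDim_quotient_le_of_forall_isPrime _ _ fun P hP hI => ?_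
  refine (ringKrullDim_quotient_le_ncard_notMem P).trans ?_
  refine Nat.cast_le.2 (hn _ fun i hi j hj _ hij => ?_)
  rcases hP.mem_or_mem (hI (Ideal.subset_span ⟨i, j, hij, rfl⟩)) with h | h
  · exact hi h
  · exact hj h

end KrullDim

/-! ### Cutpoints and matchings of a caterpillar -/

section Cutpoints

variable {V : Type*} {T : SimpleGraph V}

/-- In an acyclic graph, two neighbours of a vertex are separated by that vertex. -/
theorem not_reachable_induce_of_adj (hT : T.IsAcyclic) {v a b : V} (ha : T.Adj v a)
    (hb : T.Adj v b) (hab : a ≠ b) :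
    ¬ (T.induce {w | w ≠ v}).Reachable ⟨a, ha.ne'⟩ ⟨b, hb.ne'⟩ := by
  intro h
  have hbr := SimpleGraph.isAcyclic_iff_forall_adj_isBridge.1 hT ha
  rw [SimpleGraph.isBridge_iff] at hbr
  -- A walk avoiding `v` avoids the edge `va`; together with `vb` it would bypass that bridge.
  let φ : T.induce {w | w ≠ v} →g T.deleteEdges {s(v, a)} :=
    { toFun := Subtype.val
      map_rel' := by
        rintro ⟨x, hx⟩ ⟨y, hy⟩ hxy
        rw [SimpleGraph.deleteEdges_adj]
        refine ⟨hxy, fun he => ?_⟩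
        rcases Sym2.eq_iff.1 (Set.mem_singleton_iff.1 he) with h | h
        · exact hx h.1
        · exact hy h.2 }
  have hvb : (T.deleteEdges {s(v, a)}).Adj v b := by
    rw [SimpleGraph.deleteEdges_adj]
    refine ⟨hb, fun he => ?_⟩
    rcases Sym2.eq_iff.1 (Set.mem_singleton_iff.1 he) with h | h
    · exact hab h.2.symm
    · exact ha.ne h.1
  exact hbr (hvb.reachable.trans (h.map φ).symm)

theorem isCutpoint_of_adj_of_adj (hT : T.IsAcyclic) {v a b : V} (ha : T.Adj v a)
    (hb : T.Adj v b) (hab : a ≠ b) : IsCutpoint T v :=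
  fun h => not_reachable_induce_of_adj hT ha hb hab (h _ _)

theorem not_adj_of_adj_of_adj (hT : T.IsAcyclic) {v a b : V} (ha : T.Adj v a)
    (hb : T.Adj v b) : ¬ T.Adj a b := by
  intro hab
  refine not_reachable_induce_of_adj hT ha hb hab.ne (SimpleGraph.Adj.reachable ?_)
  simpa using hab

variable [Fintype V] [DecidableRel T.Adj]

theorem exists_three_adj {v : V} (hv : 3 ≤ T.degree v) :
    ∃ a b c, T.Adj v a ∧ T.Adj v b ∧ T.Adj v c ∧ a ≠ b ∧ a ≠ c ∧ b ≠ c := by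
  obtain ⟨a, b, c, h⟩ := Finset.two_lt_card_iff.1 (show 2 < (T.neighborFinset v).card from hv)
  exact ⟨a, b, c, by simpa using h⟩

theorem isCutpoint_of_adj_of_degree_ne_one (hT : T.IsAcyclic) {u v : V} (huv : T.Adj u v)
    (hu : T.degree u ≠ 1) : IsCutpoint T u := by
  by_contra hc
  refine hu (SimpleGraph.degree_eq_one_iff_existsUnique_adj.2 ⟨v, huv, fun w hw => ?_⟩)
  by_contra hwv
  exact hc (isCutpoint_of_adj_of_adj hT hw huv hwv)

/-- An edge with two pendant ends is a whole component, leaving no room for `w`. -/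
theorem degree_ne_one_or_of_adj (hT : T.Connected) {u v w : V} (huv : T.Adj u v)
    (hw : T.degree w ≠ 1) : T.degree u ≠ 1 ∨ T.degree v ≠ 1 := by
  by_contra! h
  obtain ⟨hu, hv⟩ := h
  have hu' := SimpleGraph.degree_eq_one_iff_existsUnique_adj.1 hu
  have hv' := SimpleGraph.degree_eq_one_iff_existsUnique_adj.1 hv
  have key : ∀ {x y : V}, T.Walk x y → x = u ∨ x = v → y = u ∨ y = v := by
    intro x y p
    induction p with
    | nil => exact id
    | cons hxz _ ih =>
      rintro (rfl | rfl)
      · exact ih (Or.inr (hu'.unique hxz huv))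
      · exact ih (Or.inl (hv'.unique hxz huv.symm))
  obtain ⟨p⟩ := hT.preconnected u w
  rcases key p (Or.inl rfl) with rfl | rfl
  · exact hw hu
  · exact hw hv

namespace IsCaterpillar

theorem exists_isCutpoint_mem (hT : IsCaterpillar T) {e : Sym2 V} (he : e ∈ T.edgeSet) :
    ∃ v ∈ e, IsCutpoint T v := by
  obtain ⟨m, hm, ⟨φ⟩⟩ := hT.backbone
  induction e with
  | h u v =>
    have huv : T.Adj u v := he
    -- The nonempty backbone supplies the non-pendant vertex.
    rcases degree_ne_one_or_of_adj hT.isTree.connected huv (φ.symm ⟨0, hm⟩).2 with h | h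
    · exact ⟨u, by simp, isCutpoint_of_adj_of_degree_ne_one hT.isTree.isAcyclic huv h⟩
    · exact ⟨v, by simp, isCutpoint_of_adj_of_degree_ne_one hT.isTree.isAcyclic huv.symm h⟩

/-- A vertex of degree at least three has a pendant neighbour, since at most two of its
neighbours lie on the backbone. -/
theorem exists_adj_degree_eq_one (hT : IsCaterpillar T) {v : V} (hv : 3 ≤ T.degree v) :
    ∃ w, T.Adj v w ∧ T.degree w = 1 := by
  obtain ⟨m, hm, ⟨φ⟩⟩ := hT.backbone
  obtain ⟨a, b, c, ha, hb, hc, hab, hac, hbc⟩ := exists_three_adj hv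
  by_contra! h
  have hv1 : T.degree v ≠ 1 := by omega
  have adj : ∀ {x : V} (hx : T.Adj v x), (φ ⟨v, hv1⟩).val + 1 = (φ ⟨x, h x hx⟩).val ∨
      (φ ⟨x, h x hx⟩).val + 1 = (φ ⟨v, hv1⟩).val := fun {x} hx =>
    SimpleGraph.pathGraph_adj.1 (φ.map_rel_iff.2 (by simpa using hx))
  have ne : ∀ {x y : V} (hx : T.Adj v x) (hy : T.Adj v y), x ≠ y →
      (φ ⟨x, h x hx⟩).val ≠ (φ ⟨y, h y hy⟩).val := fun {x y} hx hy hxy he =>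
    hxy (congrArg Subtype.val (φ.injective (Fin.ext he)))
  have h₁ := adj ha
  have h₂ := adj hb
  have h₃ := adj hc
  have h₄ := ne ha hb hab
  have h₅ := ne ha hc hac
  have h₆ := ne hb hc hbc
  -- Three distinct positions on a path cannot all be next to a fourth.
  omega

end IsCaterpillar

theorem ncard_le_ncard_isCutpoint (hT : IsCaterpillar T) {S : Set T.edgeSet}
    (hS : T.lineGraph.IsIndepSet S) : S.ncard ≤ {v | IsCutpoint T v}.ncard := by
  choose f hf hfc using fun e : T.edgeSet => hT.exists_isCutpoint_mem e.2
  refine Set.ncard_le_ncard_of_injOn f (fun e _ => hfc e) fun e he e' he' hee' => ?_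
  by_contra hne
  exact hS he he' hne
    (SimpleGraph.lineGraph_adj_iff_exists.2 ⟨hne, f e, hf e, hee' ▸ hf e'⟩)

theorem exists_isIndepSet_ncard_eq (hT : IsCaterpillar T)
    (hdeg : ∀ v, IsCutpoint T v → 3 ≤ T.degree v) :
    ∃ S : Set T.edgeSet, T.lineGraph.IsIndepSet S ∧ S.ncard = {v | IsCutpoint T v}.ncard := by
  choose f hf hf1 using fun v : {v | IsCutpoint T v} =>
    hT.exists_adj_degree_eq_one (hdeg v.1 v.2)
  let g : {v | IsCutpoint T v} → T.edgeSet := fun v => ⟨s(v.1, f v), hf v⟩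
  have ne : ∀ v w : {v | IsCutpoint T v}, v.1 ≠ f w := by
    intro v w h
    have h3 := hdeg v.1 v.2
    rw [h, hf1] at h3
    omega
  -- The chosen edges are pairwise disjoint: a shared pendant end has only one neighbour.
  have inj : ∀ v w x, x ∈ (g v).1 → x ∈ (g w).1 → v = w := by
    intro v w x hv hw
    rcases Sym2.mem_iff.1 hv with rfl | rfl <;> rcases Sym2.mem_iff.1 hw with h | h
    · exact Subtype.ext h
    · exact absurd h (ne v w)
    · exact absurd h.symm (ne w v)
    · have hu := SimpleGraph.degree_eq_one_iff_existsUnique_adj.1 (hf1 v)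
      exact Subtype.ext (hu.unique (hf v).symm (h ▸ (hf w).symm))
  refine ⟨Set.range g, ?_, ?_⟩
  · rintro _ ⟨v, rfl⟩ _ ⟨w, rfl⟩ hne hadj
    obtain ⟨x, hv, hw⟩ := (SimpleGraph.lineGraph_adj_iff_exists.1 hadj).2
    exact hne (congrArg g (inj v w x hv hw))
  · have hg : Function.Injective g := fun v w h =>
      inj v w v.1 (Sym2.mem_mk_left _ _) (h ▸ Sym2.mem_mk_left _ _)
    rw [← Nat.card_coe_set_eq, Nat.card_range_of_injective hg, Nat.card_coe_set_eq]

end Cutpoints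

/-! ### Maximal cliques of the line graph -/

section Cliques

variable {V : Type*} {T : SimpleGraph V}

/-- The edges of a graph at a given vertex, as vertices of the line graph. -/
def edgeStar (T : SimpleGraph V) (v : V) : Set T.edgeSet := {e | v ∈ e.1}

theorem isClique_edgeStar (v : V) : T.lineGraph.IsClique (edgeStar T v) :=
  fun _ he _ he' hne => SimpleGraph.lineGraph_adj_iff_exists.2 ⟨hne, v, he, he'⟩

/-- A clique of the line graph of an acyclic graph with two members lies in a star. -/
theorem exists_subset_edgeStar (hT : T.IsAcyclic) {t : Set T.edgeSet}
    (ht : T.lineGraph.IsClique t) {e f : T.edgeSet} (he : e ∈ t) (hf : f ∈ t) (hef : e ≠ f) :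
    ∃ v a b, T.Adj v a ∧ T.Adj v b ∧ a ≠ b ∧ t ⊆ edgeStar T v := by
  have meet : ∀ {g g' : T.edgeSet}, g ∈ t → g' ∈ t → ∃ x, x ∈ g.1 ∧ x ∈ g'.1 := by
    intro g g' hg hg'
    by_cases h : g = g'
    · subst h
      exact ⟨_, g.1.out_fst_mem, g.1.out_fst_mem⟩
    · exact (SimpleGraph.lineGraph_adj_iff_exists.1 (ht hg hg' h)).2
  obtain ⟨v, hve, hvf⟩ := meet he hf
  obtain ⟨a, ha⟩ := Sym2.mem_iff_exists.1 hve
  obtain ⟨b, hb⟩ := Sym2.mem_iff_exists.1 hvf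
  have hva : T.Adj v a := by simpa [ha] using e.2
  have hvb : T.Adj v b := by simpa [hb] using f.2
  have hab : a ≠ b := by
    rintro rfl
    exact hef (Subtype.ext (ha.trans hb.symm))
  refine ⟨v, a, b, hva, hvb, hab, fun g hg => ?_⟩
  by_contra hvg
  have hvg' : v ∉ g.1 := hvg
  have hag : a ∈ g.1 := by
    obtain ⟨x, hx, hxg⟩ := meet he hg
    rw [ha, Sym2.mem_iff] at hx
    rcases hx with rfl | rfl
    · exact absurd hxg hvg'
    · exact hxg
  have hbg : b ∈ g.1 := by
    obtain ⟨x, hx, hxg⟩ := meet hf hg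
    rw [hb, Sym2.mem_iff] at hx
    rcases hx with rfl | rfl
    · exact absurd hxg hvg'
    · exact hxg
  have hg' : g.1 = s(a, b) := (Sym2.mem_and_mem_iff hab).1 ⟨hag, hbg⟩
  exact not_adj_of_adj_of_adj hT hva hvb (by simpa [hg'] using g.2)

variable [Fintype V] [DecidableRel T.Adj]

/-- An edge missing `v` but meeting every edge at `v` would contain three distinct neighbours of
`v`. -/
theorem edgeStar_mem_maximalCliques {v : V} (hv : 3 ≤ T.degree v) :
    edgeStar T v ∈ maximalCliques T.lineGraph := by
  obtain ⟨a, b, c, ha, hb, hc, hab, hac, hbc⟩ := exists_three_adj hv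
  refine ⟨⟨⟨⟨s(v, a), ha⟩, Sym2.mem_mk_left _ _⟩, isClique_edgeStar v⟩, ?_⟩
  rintro t ⟨-, ht⟩ hle e he
  by_contra hve
  have hve' : v ∉ e.1 := hve
  have key : ∀ {x : V}, T.Adj v x → x ∈ e.1 := by
    intro x hx
    have hmem : (⟨s(v, x), hx⟩ : T.edgeSet) ∈ edgeStar T v := Sym2.mem_mk_left _ _
    have hne : (⟨s(v, x), hx⟩ : T.edgeSet) ≠ e := fun h => hve (h ▸ hmem)
    obtain ⟨y, hy, hye⟩ :=
      (SimpleGraph.lineGraph_adj_iff_exists.1 (ht (hle hmem) he hne)).2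
    rcases Sym2.mem_iff.1 hy with rfl | rfl
    · exact absurd hye hve'
    · exact hye
  have he' : e.1 = s(a, b) := (Sym2.mem_and_mem_iff hab).1 ⟨key ha, key hb⟩
  have hce := key hc
  rw [he', Sym2.mem_iff] at hce
  rcases hce with h | h
  · exact hac h.symm
  · exact hbc h.symm

theorem eq_of_edgeStar_eq {v w : V} (hv : 3 ≤ T.degree v)
    (h : edgeStar T v = edgeStar T w) : v = w := by
  obtain ⟨a, b, -, ha, hb, -, hab, -, -⟩ := exists_three_adj hv
  have key : ∀ {x : V}, T.Adj v x → w = v ∨ w = x := by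
    intro x hx
    have hmem : (⟨s(v, x), hx⟩ : T.edgeSet) ∈ edgeStar T v := Sym2.mem_mk_left _ _
    rw [h] at hmem
    exact Sym2.mem_iff.1 hmem
  rcases key ha with h₁ | h₁
  · exact h₁.symm
  · rcases key hb with h₂ | h₂
    · exact h₂.symm
    · exact absurd (h₁.symm.trans h₂) hab

theorem exists_edgeStar_eq_of_mem_maximalCliques (hT : IsCaterpillar T) {t : Set T.edgeSet}
    (ht : t ∈ maximalCliques T.lineGraph) : ∃ v, IsCutpoint T v ∧ edgeStar T v = t := by
  obtain ⟨⟨⟨e, he⟩, hcl⟩, hmax⟩ := ht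
  suffices h : ∃ v, IsCutpoint T v ∧ t ⊆ edgeStar T v by
    obtain ⟨v, hv, hsub⟩ := h
    exact ⟨v, hv, (hmax ⟨⟨e, hsub he⟩, isClique_edgeStar v⟩ hsub).antisymm hsub⟩
  by_cases h : ∃ f ∈ t, e ≠ f
  · obtain ⟨f, hf, hef⟩ := h
    obtain ⟨v, a, b, ha, hb, hab, hsub⟩ :=
      exists_subset_edgeStar hT.isTree.isAcyclic hcl he hf hef
    exact ⟨v, isCutpoint_of_adj_of_adj hT.isTree.isAcyclic ha hb hab, hsub⟩
  -- The clique is the single edge `e`, which lies in the star of any cutpoint on it.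
  · push Not at h
    obtain ⟨v, hve, hv⟩ := hT.exists_isCutpoint_mem e.2
    exact ⟨v, hv, fun f hf => h f hf ▸ hve⟩

theorem ncard_isCutpoint_eq_ncard_maximalCliques (hT : IsCaterpillar T)
    (hdeg : ∀ v, IsCutpoint T v → 3 ≤ T.degree v) :
    {v | IsCutpoint T v}.ncard = (maximalCliques T.lineGraph).ncard :=
  Set.ncard_congr (fun v _ => edgeStar T v)
    (fun v hv => edgeStar_mem_maximalCliques (hdeg v hv))
    (fun v _ hv _ h => eq_of_edgeStar_eq (hdeg v hv) h)
    fun _ ht => by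
      obtain ⟨v, hv, h⟩ := exists_edgeStar_eq_of_mem_maximalCliques hT ht
      exact ⟨v, hv, h⟩

end Cliques

end LineGraphEdgeIdeal

theorem proposition3p6 {k : Type*} [Field k] {V : Type*} [Fintype V]
    (T : SimpleGraph V) [DecidableRel T.Adj]
    (hT : LineGraphEdgeIdeal.IsCaterpillar T)
    (hdeg : ∀ v : V, LineGraphEdgeIdeal.IsCutpoint T v → 3 ≤ T.degree v) :
    ringKrullDim
        (MvPolynomial T.edgeSet k ⧸ LineGraphEdgeIdeal.edgeIdeal k T.lineGraph) =
      (({v : V | LineGraphEdgeIdeal.IsCutpoint T v}.ncard : ℕ) : WithBot ℕ∞) ∧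
    {v : V | LineGraphEdgeIdeal.IsCutpoint T v}.ncard =
      (LineGraphEdgeIdeal.maximalCliques T.lineGraph).ncard := by
  refine ⟨le_antisymm ?_ ?_,
    LineGraphEdgeIdeal.ncard_isCutpoint_eq_ncard_maximalCliques hT hdeg⟩
  · exact LineGraphEdgeIdeal.ringKrullDim_quotient_edgeIdeal_le fun _ hS =>
      LineGraphEdgeIdeal.ncard_le_ncard_isCutpoint hT hS
  · obtain ⟨S, hS, hcard⟩ := LineGraphEdgeIdeal.exists_isIndepSet_ncard_eq hT hdeg
    rw [← hcard]
    exact LineGraphEdgeIdeal.ncard_le_ringKrullDim_quotient_edgeIdeal hS
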